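/- Work over $\mathbb{C}$. For a projective variety $X\subset\mathbb{P}^N$ and $q\in X$ let $T_qX\subset\mathbb{P}^N$ be the embedded tangent space, and say that a linear subspace $\Pi\subset\mathbb{P}^N$ is tangent to $X$ at $q$ if $T_qX\subseteq\Pi$. Given $x_1,\dots,x_h\in X$ and a linear subspace $\Pi$ of dimension $s$ containing $\langle T_{x_1}X,\dots,T_{x_h}X\rangle$, the $(h,s)$-tangential contact locus $\Gamma_{x_1,\dots,x_h,\Pi}$ is the closure in $X$ of the union of those irreducible components of $\{q\in X : \Pi \text{ is tangent to } X \text{ at } q\}$ that contain at least one of the $x_i$. The variety $X$ is called $(h,s)$-tangentially weakly defective if $\dim\Gamma_{x_1,\dots,x_h,\Pi}>0$ for general $x_1,\dots,x_h\in X$ and a general $s$-dimensional $\Pi\supseteq\langle T_{x_1}X,\dots,T_{x_h}X\rangle$; here "general" means in a nonempty Zariski open subset of $X^h$, respectively of the Grassmannian of such $\Pi$ (so $X$ is not $(h,s)$-tangentially weakly defective if no such $\Pi$ exists). Let $n,d\ge 1$ be integers, let $N=(d+1)(n+1)-1$, and let $SV\subset\mathbb{P}^{N}$ be the Segre–Veronese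 variety, i.e. $\mathbb{P}^1\times\mathbb{P}^n$ embedded by the complete linear system $|\mathcal{O}_{\mathbb{P}^1\times\mathbb{P}^n}(d,1)|$. Then for every integer $0\le s\le N$, the variety $SV$ is not $(1,s)$-tangentially weakly defective if and only if $s\le d(n+1)$. -/

import Mathlib

noncomputable section

/-- Affine space with coordinates indexed by `σ` over the complex numbers.  It is a separate type,
so that it carries the Zariski topology and not the product topology of `σ → ℂ`. -/
def AffSpace (σ : Type) : Type := σ → ℂ

/-- The Zariski topology on affine space: the closed sets are the zero loci of ideals of
polynomials. -/
@[reducible] def zariskiTopology (σ : Type) : TopologicalSpace (σ → ℂ) :=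
  TopologicalSpace.ofClosed
    {Z : Set (σ → ℂ) | ∃ I : Ideal (MvPolynomial σ ℂ), Z = MvPolynomial.zeroLocus ℂ I}
    ⟨⊤, MvPolynomial.zeroLocus_top.symm⟩
    (by
      intro A hA
      refine ⟨sSup {I | MvPolynomial.zeroLocus ℂ I ∈ A}, ?_⟩
      ext x
      have key : ∀ J : Ideal (MvPolynomial σ ℂ),
          x ∈ MvPolynomial.zeroLocus ℂ J ↔ J ≤ MvPolynomial.vanishingIdeal ℂ {x} := fun J => by
        rw [← MvPolynomial.le_zeroLocus_iff_le_vanishingIdeal]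
        exact Set.singleton_subset_iff.symm
      rw [key, sSup_le_iff, Set.mem_sInter]
      constructor
      · intro h J hJ
        exact (key J).1 (h _ hJ)
      · intro h Z hZ
        obtain ⟨J, rfl⟩ := hA hZ
        exact (key J).2 (h J hZ))
    (by
      rintro _ ⟨I, rfl⟩ _ ⟨J, rfl⟩
      refine ⟨I * J, ?_⟩
      ext x
      constructor
      · rintro (h | h)
        · exact MvPolynomial.zeroLocus_anti_mono (Ideal.mul_le_left (I := I) (J := J)) h
        · exact MvPolynomial.zeroLocus_anti_mono (Ideal.mul_le_right (I := I) (J := J)) h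
      · intro h
        by_contra hcon
        rw [Set.mem_union, not_or] at hcon
        obtain ⟨h1, h2⟩ := hcon
        simp only [MvPolynomial.mem_zeroLocus_iff, not_forall] at h1 h2
        obtain ⟨p, hp, hp0⟩ := h1
        obtain ⟨q, hq, hq0⟩ := h2
        have := h (p * q) (Ideal.mul_mem_mul hp hq)
        rw [map_mul] at this
        exact (mul_ne_zero hp0 hq0) this)

instance (σ : Type) : TopologicalSpace (AffSpace σ) := zariskiTopology σ

/-- Complex projective space of lines in `ι → ℂ`. -/
def ProjSpace (ι : Type) : Type := Projectivization ℂ (ι → ℂ)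

/-- The point of projective space with homogeneous coordinates `v`. -/
def ProjSpace.mk {ι : Type} (v : ι → ℂ) (hv : v ≠ 0) : ProjSpace ι :=
  Projectivization.mk ℂ v hv

/-- Homogeneous coordinates of a point of projective space. -/
def ProjSpace.rep {ι : Type} (x : ProjSpace ι) : ι → ℂ :=
  Projectivization.rep (K := ℂ) (V := ι → ℂ) x

/-- The Zariski topology on projective space: a set is closed if and only if its cone is Zariski
closed in the affine space without the origin. -/
instance (ι : Type) : TopologicalSpace (ProjSpace ι) :=
  TopologicalSpace.coinduced
    (fun v : {v : AffSpace ι // v ≠ (0 : ι → ℂ)} => ProjSpace.mk v.1 v.2) inferInstance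

/-- The `h`-fold product of projective space with itself. -/
def ProjTuple (h : ℕ) (ι : Type) : Type := Fin h → ProjSpace ι

/-- The Zariski topology on the `h`-fold product of projective space (not the product of the
Zariski topologies): a set is closed if and only if its multicone is Zariski closed in the space of
`h`-tuples of nonzero vectors. -/
instance (h : ℕ) (ι : Type) : TopologicalSpace (ProjTuple h ι) :=
  TopologicalSpace.coinduced
    (fun (v : {v : AffSpace (Fin h × ι) // ∀ k : Fin h, (fun i => v (k, i)) ≠ (0 : ι → ℂ)}) =>
      ((fun k => ProjSpace.mk (fun i => v.1 (k, i)) (v.2 k)) : ProjTuple h ι)) inferInstance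

/-- The homogeneous ideal of a subset `X` of projective space: the polynomials that vanish on the
affine cone over `X`. -/
def coneIdeal {ι : Type} (X : Set (ProjSpace ι)) : Ideal (MvPolynomial ι ℂ) :=
  MvPolynomial.vanishingIdeal ℂ
    {v : ι → ℂ | ∃ hv : v ≠ 0, ProjSpace.mk v hv ∈ X}

/-- The embedded (projective) tangent space of `X` at `x`, as a linear subspace of the vector space
of homogeneous coordinates; its projective dimension is its linear dimension minus one. -/
def tangentSpaceAt {ι : Type} [Fintype ι] (X : Set (ProjSpace ι)) (x : ProjSpace ι) :
    Submodule ℂ (ι → ℂ) :=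
  ⨅ F ∈ coneIdeal X,
    LinearMap.ker (∑ i, (MvPolynomial.eval x.rep (MvPolynomial.pderiv i F)) •
      (LinearMap.proj i : (ι → ℂ) →ₗ[ℂ] ℂ))

/-- The span `⟨T_{x_1} X, …, T_{x_h} X⟩`. -/
def tangentSpan {ι : Type} [Fintype ι] (X : Set (ProjSpace ι)) {h : ℕ} (x : ProjTuple h ι) :
    Submodule ℂ (ι → ℂ) :=
  ⨆ k, tangentSpaceAt X (x k)

/-- The linear subspaces of projective dimension `s` that contain `T`. -/
def SubspacesContaining {ι : Type} (T : Submodule ℂ (ι → ℂ)) (s : ℕ) : Type :=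
  {L : Submodule ℂ (ι → ℂ) // T ≤ L ∧ Module.finrank ℂ L = s + 1}

/-- The tuples of vectors that extend `T` to a linear subspace of projective dimension `s`, as a
subset of affine space. -/
def Frames {ι : Type} (T : Submodule ℂ (ι → ℂ)) (s : ℕ) : Type :=
  {v : AffSpace (Fin (s + 1 - Module.finrank ℂ T) × ι) //
    Module.finrank ℂ
      ↥(T ⊔ Submodule.span ℂ (Set.range fun k => ((fun i => v (k, i)) : ι → ℂ))) = s + 1}

instance {ι : Type} (T : Submodule ℂ (ι → ℂ)) (s : ℕ) : TopologicalSpace (Frames T s) :=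
  inferInstanceAs (TopologicalSpace {v : AffSpace (Fin (s + 1 - Module.finrank ℂ T) × ι) //
    Module.finrank ℂ
      ↥(T ⊔ Submodule.span ℂ (Set.range fun k => ((fun i => v (k, i)) : ι → ℂ))) = s + 1})

/-- The Zariski topology on the Grassmannian of linear subspaces of projective dimension `s` that
contain `T`: a family is open if and only if the frames of its members form a Zariski open set of
frames. -/
instance {ι : Type} (T : Submodule ℂ (ι → ℂ)) (s : ℕ) :
    TopologicalSpace (SubspacesContaining T s) :=
  TopologicalSpace.coinduced
    (fun v : Frames T s =>
      (⟨T ⊔ Submodule.span ℂ (Set.range fun k => ((fun i => v.1 (k, i)) : ι → ℂ)),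
        le_sup_left, v.2⟩ : SubspacesContaining T s)) inferInstance

/-- The locus of points of `X` where the linear subspace `L` is tangent to `X`. -/
def tangencyLocus {ι : Type} [Fintype ι] (X : Set (ProjSpace ι)) (L : Submodule ℂ (ι → ℂ)) :
    Set (ProjSpace ι) :=
  {q ∈ X | tangentSpaceAt X q ≤ L}

/-- The `(h,s)`-tangential contact locus of `X` with respect to `x_1, …, x_h` and `L`: the closure
in `X` of the union of the irreducible components of the tangency locus of `L` that contain at
least one of the `x_k`. -/
def contactLocus {ι : Type} [Fintype ι] (X : Set (ProjSpace ι)) {h : ℕ} (x : ProjTuple h ι)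
    (L : Submodule ℂ (ι → ℂ)) : Set (ProjSpace ι) :=
  X ∩ closure (⋃₀ {C | Maximal (fun C => IsIrreducible C ∧ C ⊆ tangencyLocus X L) C ∧
    ∃ k, x k ∈ C})

/-- `X` is `(h,s)`-tangentially weakly defective: for `x` in a nonempty Zariski open subset of
`X ^ h`, and for `L` in a nonempty Zariski open subset of the Grassmannian of linear subspaces of
projective dimension `s` containing `⟨T_{x_1} X, …, T_{x_h} X⟩`, the contact locus has positive
dimension. -/
def IsTangentiallyWeaklyDefective {ι : Type} [Fintype ι] (X : Set (ProjSpace ι)) (h s : ℕ) :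
    Prop :=
  ∃ U : Set {x : ProjTuple h ι // ∀ k, x k ∈ X}, IsOpen U ∧ U.Nonempty ∧
    ∀ x ∈ U, ∃ W : Set (SubspacesContaining (tangentSpan X x.1) s), IsOpen W ∧ W.Nonempty ∧
      ∀ L ∈ W, 0 < topologicalKrullDim ↥(contactLocus X x.1 L.1)

/-- The bihomogeneous monomials `X_0^(d-i) X_1^i Y_j` of bidegree `(d,1)`. -/
def segreVeroneseVec (n d : ℕ) (a : Fin 2 → ℂ) (b : Fin (n + 1) → ℂ) :
    Fin (d + 1) × Fin (n + 1) → ℂ :=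
  fun ij => a 0 ^ (d - (ij.1 : ℕ)) * a 1 ^ (ij.1 : ℕ) * b ij.2

lemma segreVeroneseVec_ne_zero (n d : ℕ) {a : Fin 2 → ℂ} {b : Fin (n + 1) → ℂ}
    (ha : a ≠ 0) (hb : b ≠ 0) : segreVeroneseVec n d a b ≠ 0 := by
  obtain ⟨j, hj⟩ := Function.ne_iff.1 hb
  obtain ⟨i, hi⟩ := Function.ne_iff.1 ha
  intro h
  have hi' : a 0 ≠ 0 ∨ a 1 ≠ 0 := by
    fin_cases i
    · exact Or.inl hi
    · exact Or.inr hi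
  rcases hi' with h0 | h1
  · have := congrFun h (0, j)
    simp [segreVeroneseVec, h0] at this
    exact hj this
  · have := congrFun h (Fin.last d, j)
    simp [segreVeroneseVec, h1] at this
    exact hj this

/-- The Segre–Veronese variety: the image of `ℙ¹ × ℙⁿ` in the projective space of dimension
`(d + 1) * (n + 1) - 1` under the embedding given by all monomials of bidegree `(d,1)`. -/
def segreVeronese (n d : ℕ) : Set (ProjSpace (Fin (d + 1) × Fin (n + 1))) :=
  {z | ∃ (a : Fin 2 → ℂ) (b : Fin (n + 1) → ℂ) (ha : a ≠ 0) (hb : b ≠ 0),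
    z = ProjSpace.mk (segreVeroneseVec n d a b) (segreVeroneseVec_ne_zero n d ha hb)}

end

noncomputable section

/-! Write V = ℂ^(n+1) and view the ambient space as binary forms of degree d with values in V, so
that points of SV are a^d ⊗ b. The tangent space at such a point is T = a^d ⊗ V + ⟨a^(d-1) a' ⊗ b⟩,
of linear dimension n + 2. The tangent spaces along the fibre {a} × ℙⁿ span M = a^d ⊗ V + a^(d-1) a'
⊗ V, of dimension 2(n + 1). For L ⊇ T everything depends on whether L ∩ M = T.

If L ∩ M = T, then L is proper, because n ≥ 1 makes T ≠ M. A linear form vanishing on L restricts to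
the a^d ⊗ e_j as binary forms in a, not all zero, so only finitely many fibres can carry tangency
points; on the fibre of x, the only one is x itself. Hence x is isolated
(`contactLocus_segreVeronese_subsingleton`). If L ∩ M is larger, it contains some a^(d-1) a' ⊗ b'
modulo T with b' not proportional to b, and L is tangent along the line a^d ⊗ (b + t b')
(`contactLocus_segreVeronese_krullDim_pos`).

It remains to count dimensions: a general L of dimension s + 1 meets M only in T exactly when (s + 1
- (n + 2)) + 2(n + 1) ≤ (d + 1)(n + 1), that is s ≤ d(n + 1). Below the bound a transversal L is
found in every nonempty open family (`exists_mem_inf_le`); above it, every L meets M in too much. -/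

/-! ### Zariski topology of affine and projective space -/

lemma AffSpace.isOpen_iff {σ : Type} {O : Set (AffSpace σ)} :
    IsOpen O ↔ ∃ I : Ideal (MvPolynomial σ ℂ), Oᶜ = MvPolynomial.zeroLocus ℂ I := Iff.rfl

/-- Basic open sets form a basis of the Zariski topology of affine space. -/
lemma AffSpace.exists_polynomial_of_mem {σ : Type} {O : Set (AffSpace σ)} (hO : IsOpen O)
    {v : AffSpace σ} (hv : v ∈ O) :
    ∃ F : MvPolynomial σ ℂ, MvPolynomial.eval v F ≠ 0 ∧
      ∀ w : AffSpace σ, MvPolynomial.eval w F ≠ 0 → w ∈ O := by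
  obtain ⟨I, hI⟩ := AffSpace.isOpen_iff.1 hO
  have hmem : ∀ w : AffSpace σ, w ∉ O ↔ ∀ p ∈ I, MvPolynomial.eval w p = 0 := fun w => by
    rw [← Set.mem_compl_iff, hI]
    exact MvPolynomial.mem_zeroLocus_iff
  have h := mt (hmem v).2 (not_not.2 hv)
  push Not at h
  obtain ⟨F, hF, hFv⟩ := h
  exact ⟨F, hFv, fun w hw => by_contra fun hwO => hw ((hmem w).1 hwO F hF)⟩

/-- Open sets are tested on the cone, so the polynomial F need not be homogeneous. -/
lemma ProjSpace.exists_polynomial_of_mem {ι : Type} {U : Set (ProjSpace ι)} (hU : IsOpen U)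
    {v : ι → ℂ} (hv : v ≠ 0) (hvU : ProjSpace.mk v hv ∈ U) :
    ∃ F : MvPolynomial ι ℂ, MvPolynomial.eval v F ≠ 0 ∧
      ∀ (w : ι → ℂ) (hw : w ≠ 0), MvPolynomial.eval w F ≠ 0 → ProjSpace.mk w hw ∈ U := by
  obtain ⟨O, hO, hOU⟩ := isOpen_induced_iff.1 (isOpen_coinduced.1 hU)
  have key : ∀ (w : ι → ℂ) (hw : w ≠ 0), w ∈ O ↔ ProjSpace.mk w hw ∈ U := fun w hw =>
    Set.ext_iff.1 hOU ⟨w, hw⟩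
  obtain ⟨F, hF, hFO⟩ := AffSpace.exists_polynomial_of_mem hO ((key v hv).2 hvU)
  exact ⟨F, hF, fun w hw h => (key w hw).1 (hFO w h)⟩

lemma ProjSpace.rep_ne_zero {ι : Type} (x : ProjSpace ι) : x.rep ≠ 0 :=
  Projectivization.rep_nonzero x

lemma ProjSpace.mk_rep {ι : Type} (x : ProjSpace ι) : ProjSpace.mk x.rep x.rep_ne_zero = x :=
  Projectivization.mk_rep x

lemma ProjSpace.exists_rep_mk {ι : Type} (v : ι → ℂ) (hv : v ≠ 0) :
    ∃ c : ℂ, c ≠ 0 ∧ (ProjSpace.mk v hv).rep = c • v := by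
  obtain ⟨a, ha⟩ := Projectivization.exists_smul_eq_mk_rep ℂ v hv
  exact ⟨a, a.ne_zero, ha.symm⟩

lemma ProjSpace.mk_eq_mk_of_smul {ι : Type} {v w : ι → ℂ} (hv : v ≠ 0) (hw : w ≠ 0) {c : ℂ}
    (h : w = c • v) : ProjSpace.mk v hv = ProjSpace.mk w hw :=
  ((Projectivization.mk_eq_mk_iff' ℂ w v hw hv).2 ⟨c, h.symm⟩).symm

lemma ProjSpace.rep_mk_mem_iff {ι : Type} (A : Submodule ℂ (ι → ℂ)) (v : ι → ℂ) (hv : v ≠ 0) :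
    (ProjSpace.mk v hv).rep ∈ A ↔ v ∈ A := by
  obtain ⟨c, hc, h⟩ := ProjSpace.exists_rep_mk v hv
  rw [h]
  exact A.smul_mem_iff hc

/-- A vector outside A is separated from A by a linear form, which is a polynomial of degree one. -/
lemma zeroLocus_vanishingIdeal_submodule {ι : Type} [Fintype ι] (A : Submodule ℂ (ι → ℂ)) :
    MvPolynomial.zeroLocus ℂ (MvPolynomial.vanishingIdeal ℂ (A : Set (ι → ℂ))) =
      (A : Set (ι → ℂ)) := by
  classical
  refine Set.Subset.antisymm (fun v hv => ?_) (MvPolynomial.zeroLocus_vanishingIdeal_le _)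
  by_contra hvA
  obtain ⟨l, hlv, hlA⟩ := Submodule.exists_le_ker_of_notMem hvA
  have hl : ∀ w : ι → ℂ,
      MvPolynomial.aeval w (∑ i, MvPolynomial.C (l (Pi.single i 1)) * MvPolynomial.X i) = l w := by
    intro w
    rw [LinearMap.pi_apply_eq_sum_univ l w]
    simp only [map_sum, map_mul, MvPolynomial.aeval_C, MvPolynomial.aeval_X, smul_eq_mul,
      Algebra.algebraMap_self, RingHom.id_apply]
    refine Finset.sum_congr rfl fun i _ => ?_
    rw [mul_comm]
    congr 2
    ext j
    simp [Pi.single_apply, eq_comm]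
  refine hlv ?_
  rw [← hl v]
  refine hv _ ?_
  intro w hw
  rw [hl w]
  exact hlA hw

/-- Linear subspaces of projective space are closed. -/
lemma ProjSpace.isClosed_rep_mem {ι : Type} [Fintype ι] (A : Submodule ℂ (ι → ℂ)) :
    IsClosed {z : ProjSpace ι | z.rep ∈ A} := by
  rw [← isOpen_compl_iff, isOpen_coinduced, isOpen_induced_iff]
  refine ⟨(A : Set (ι → ℂ))ᶜ, AffSpace.isOpen_iff.2
    ⟨MvPolynomial.vanishingIdeal ℂ (A : Set (ι → ℂ)), ?_⟩, ?_⟩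
  · rw [zeroLocus_vanishingIdeal_submodule]
    exact compl_compl _
  · ext v
    exact not_congr (ProjSpace.rep_mk_mem_iff A v.1 v.2).symm

lemma ProjSpace.eq_of_rep_mem_span {ι : Type} {x z : ProjSpace ι}
    (h : z.rep ∈ Submodule.span ℂ {x.rep}) : z = x := by
  obtain ⟨c, hc⟩ := Submodule.mem_span_singleton.1 h
  rw [← x.mk_rep, ← z.mk_rep]
  exact (ProjSpace.mk_eq_mk_of_smul x.rep_ne_zero z.rep_ne_zero hc.symm).symm

instance (ι : Type) [Fintype ι] : T1Space (ProjSpace ι) where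
  t1 x := by
    convert ProjSpace.isClosed_rep_mem (Submodule.span ℂ {x.rep}) using 1
    ext z
    refine ⟨?_, fun h => ProjSpace.eq_of_rep_mem_span h⟩
    rintro rfl
    exact Submodule.mem_span_singleton_self _

/-! ### Polynomial curves and irreducible lines -/

/-- The evaluation of a polynomial along a polynomial curve. -/
lemma eval_aeval_polynomial {ι : Type} (g : ι → Polynomial ℂ) (F : MvPolynomial ι ℂ) (t : ℂ) :
    (MvPolynomial.aeval g F).eval t = MvPolynomial.eval (fun i => (g i).eval t) F := by
  induction F using MvPolynomial.induction_on with
  | C a => simp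
  | add p q hp hq => simp [hp, hq]
  | mul_X p i hp => simp [hp]

/-- The chain rule for a polynomial along a polynomial curve. -/
lemma derivative_aeval_polynomial {ι : Type} [Fintype ι] (g : ι → Polynomial ℂ)
    (F : MvPolynomial ι ℂ) :
    Polynomial.derivative (MvPolynomial.aeval g F) =
      ∑ i, MvPolynomial.aeval g (MvPolynomial.pderiv i F) * Polynomial.derivative (g i) := by
  classical
  induction F using MvPolynomial.induction_on with
  | C a => simp
  | add p q hp hq => simp [hp, hq, add_mul, Finset.sum_add_distrib]
  | mul_X p j hp =>
    have h : ∀ i, MvPolynomial.aeval g (MvPolynomial.pderiv i (p * MvPolynomial.X j)) *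
        Polynomial.derivative (g i) = MvPolynomial.aeval g (MvPolynomial.pderiv i p) *
          Polynomial.derivative (g i) * g j +
        if i = j then MvPolynomial.aeval g p * Polynomial.derivative (g i) else 0 := by
      intro i
      rw [MvPolynomial.pderiv_mul, map_add, map_mul, map_mul, MvPolynomial.aeval_X]
      split_ifs with hij
      · rw [hij, MvPolynomial.pderiv_X_self, map_one]
        ring
      · rw [MvPolynomial.pderiv_X_of_ne (Ne.symm hij), map_zero]
        ring
    rw [map_mul, MvPolynomial.aeval_X, Polynomial.derivative_mul, hp,
      Finset.sum_congr rfl fun i _ => h i, Finset.sum_add_distrib, Finset.sum_mul]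
    simp

/-- An affine line that misses the origin maps to an irreducible subset of projective space. -/
lemma ProjSpace.isIrreducible_line {ι : Type} (u w : ι → ℂ) (h : ∀ t : ℂ, u + t • w ≠ 0) :
    IsIrreducible (Set.range fun t : ℂ => ProjSpace.mk (u + t • w) (h t)) := by
  refine ⟨Set.range_nonempty _, ?_⟩
  have key : ∀ U : Set (ProjSpace ι), IsOpen U →
      (Set.range (fun t : ℂ => ProjSpace.mk (u + t • w) (h t)) ∩ U).Nonempty →
      ∃ P : Polynomial ℂ, P ≠ 0 ∧
        ∀ t, P.eval t ≠ 0 → ProjSpace.mk (u + t • w) (h t) ∈ U := by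
    rintro U hU ⟨_, ⟨t, rfl⟩, ht⟩
    obtain ⟨F, hF, hFU⟩ := ProjSpace.exists_polynomial_of_mem hU (h t) ht
    have hev : ∀ t : ℂ, (MvPolynomial.aeval
        (fun i => Polynomial.C (u i) + Polynomial.X * Polynomial.C (w i)) F).eval t =
          MvPolynomial.eval (u + t • w) F := fun t => by
      rw [eval_aeval_polynomial]
      congr
      ext i
      simp only [Polynomial.eval_add, Polynomial.eval_mul, Polynomial.eval_C, Polynomial.eval_X,
        Pi.add_apply, Pi.smul_apply, smul_eq_mul]
    refine ⟨MvPolynomial.aeval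
      (fun i => Polynomial.C (u i) + Polynomial.X * Polynomial.C (w i)) F, ?_, ?_⟩
    · intro h0
      apply hF
      rw [← hev t, h0, Polynomial.eval_zero]
    · intro t ht
      rw [hev] at ht
      exact hFU _ _ ht
  intro U₁ U₂ hU₁ hU₂ h₁ h₂
  obtain ⟨P, hP, hPU⟩ := key U₁ hU₁ h₁
  obtain ⟨Q, hQ, hQU⟩ := key U₂ hU₂ h₂
  obtain ⟨t, ht⟩ : ∃ t, (P * Q).eval t ≠ 0 := by
    by_contra! h0
    exact mul_ne_zero hP hQ (Polynomial.funext (by simpa using h0))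
  rw [Polynomial.eval_mul] at ht
  exact ⟨_, ⟨t, rfl⟩, hPU t (left_ne_zero_of_mul ht), hQU t (right_ne_zero_of_mul ht)⟩

/-! ### Irreducible components, dimension and contact loci -/

/-- Zorn's lemma: two open sets meeting the union of a chain already meet its larger relevant
member, so the union is irreducible. -/
lemma exists_maximal_irreducible_subset {Y : Type*} [TopologicalSpace Y] {C Z : Set Y}
    (hC : IsIrreducible C) (hCZ : C ⊆ Z) :
    ∃ D, C ⊆ D ∧ Maximal (fun D => IsIrreducible D ∧ D ⊆ Z) D := by
  refine zorn_le_nonempty₀ {D | IsIrreducible D ∧ D ⊆ Z} ?_ C ⟨hC, hCZ⟩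
  intro c hc hchain D hD
  refine ⟨⋃₀ c, ⟨⟨(hc hD).1.nonempty.mono (Set.subset_sUnion_of_mem hD), ?_⟩,
    Set.sUnion_subset fun E hE => (hc hE).2⟩, fun E hE => Set.subset_sUnion_of_mem hE⟩
  rintro U₁ U₂ hU₁ hU₂ ⟨y, ⟨E, hE, hyE⟩, hyU⟩ ⟨z, ⟨G, hG, hzG⟩, hzU⟩
  rcases hchain.total hE hG with hEG | hGE
  · exact ((hc hG).1.isPreirreducible U₁ U₂ hU₁ hU₂ ⟨y, hEG hyE, hyU⟩ ⟨z, hzG, hzU⟩).mono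
      (Set.inter_subset_inter_left _ (Set.subset_sUnion_of_mem hG))
  · exact ((hc hE).1.isPreirreducible U₁ U₂ hU₁ hU₂ ⟨y, hyE, hyU⟩ ⟨z, hGE hzG, hzU⟩).mono
      (Set.inter_subset_inter_left _ (Set.subset_sUnion_of_mem hE))

/-- The chain {y} ⊊ C has length one in C, and dimension does not drop on passing to S. -/
lemma topologicalKrullDim_pos_of_isIrreducible {Y : Type*} [TopologicalSpace Y] [T1Space Y]
    {C S : Set Y} (hC : IsIrreducible C) (hCS : C ⊆ S) (hn : C.Nontrivial) :
    0 < topologicalKrullDim ↥S := by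
  refine lt_of_lt_of_le ?_ (Topology.IsEmbedding.inclusion hCS).isInducing.topologicalKrullDim_le
  have : IrreducibleSpace ↥C := isIrreducible_iff_irreducibleSpace.1 hC
  obtain ⟨y, hy, z, hz, hyz⟩ := hn
  refine Order.krullDim_pos_iff.2 ⟨⟨{⟨y, hy⟩}, isIrreducible_singleton, isClosed_singleton⟩,
    ⟨Set.univ, IrreducibleSpace.isIrreducible_univ _, isClosed_univ⟩, lt_of_le_of_ne
      (Set.subset_univ _) ?_⟩
  intro h
  have h' : ({⟨y, hy⟩} : Set ↥C) = Set.univ := congrArg TopologicalSpace.IrreducibleCloseds.carrier h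
  have hz' : (⟨z, hz⟩ : ↥C) ∈ ({⟨y, hy⟩} : Set ↥C) := h' ▸ Set.mem_univ _
  exact hyz (congrArg Subtype.val hz').symm

lemma not_topologicalKrullDim_pos_of_subsingleton {Y : Type*} [TopologicalSpace Y] {S : Set Y}
    (hS : S.Subsingleton) : ¬ 0 < topologicalKrullDim ↥S := by
  have := hS.coe_sort
  exact not_lt.2 (topologicalKrullDim_zero_of_discreteTopology _)

/-- If the tangency locus is covered by `{x 0}` and a closed set that does not contain `x 0`, then
the contact locus is at most the point `x 0`. -/
lemma contactLocus_subsingleton {ι : Type} [Fintype ι] {X : Set (ProjSpace ι)}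
    (x : ProjTuple 1 ι) (L : Submodule ℂ (ι → ℂ)) (Z : Set (ProjSpace ι)) (hZ : IsClosed Z)
    (hxZ : x 0 ∉ Z) (h : tangencyLocus X L ⊆ {x 0} ∪ Z) : (contactLocus X x L).Subsingleton := by
  refine Set.Subsingleton.anti (Set.subsingleton_singleton (a := x 0)) ?_
  refine Set.inter_subset_right.trans (closure_minimal ?_ isClosed_singleton)
  refine Set.sUnion_subset ?_
  rintro C ⟨hC, k, hk⟩
  rw [Subsingleton.elim k 0] at hk
  rcases isPreirreducible_iff_isClosed_union_isClosed.1 hC.prop.1.isPreirreducible {x 0} Z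
    isClosed_singleton hZ (hC.prop.2.trans h) with h1 | h1
  · exact h1
  · exact absurd (h1 hk) hxZ

/-- A nontrivial irreducible set of tangency points through `x k` makes the contact locus
positive-dimensional. -/
lemma contactLocus_krullDim_pos {ι : Type} [Fintype ι] {X : Set (ProjSpace ι)} {h : ℕ}
    (x : ProjTuple h ι) (L : Submodule ℂ (ι → ℂ)) {C : Set (ProjSpace ι)} (hC : IsIrreducible C)
    (hn : C.Nontrivial) (hCL : C ⊆ tangencyLocus X L) {k : Fin h} (hk : x k ∈ C) :
    0 < topologicalKrullDim ↥(contactLocus X x L) := by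
  obtain ⟨D, hCD, hD⟩ := exists_maximal_irreducible_subset hC hCL
  refine topologicalKrullDim_pos_of_isIrreducible hC (fun y hy => ?_) hn
  exact ⟨(hCL hy).1, subset_closure ⟨D, ⟨hD, k, hCD hk⟩, hCD hy⟩⟩

/-! ### Multilinear algebra of a^d ⊗ V -/

/-- The linear map `C_d ⊗ V → C_{d-1} ⊗ V` whose kernel is `a ^ d ⊗ V`. -/
def crossMap (n d : ℕ) (a : Fin 2 → ℂ) :
    (Fin (d + 1) × Fin (n + 1) → ℂ) →ₗ[ℂ] (Fin d × Fin (n + 1) → ℂ) where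
  toFun w := fun ij => a 1 * w (ij.1.castSucc, ij.2) - a 0 * w (ij.1.succ, ij.2)
  map_add' v w := by ext ij; simp only [Pi.add_apply]; ring
  map_smul' c w := by
    ext ij; simp only [Pi.smul_apply, smul_eq_mul, RingHom.id_apply]; ring

/-- The tensor `a ^ (d - 1) ⊗ b` as a linear function of `b`. -/
def lowerMap (n d : ℕ) (a : Fin 2 → ℂ) :
    (Fin (n + 1) → ℂ) →ₗ[ℂ] (Fin d × Fin (n + 1) → ℂ) where
  toFun b := fun ij => a 0 ^ (d - 1 - (ij.1 : ℕ)) * a 1 ^ (ij.1 : ℕ) * b ij.2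
  map_add' v w := by ext ij; simp only [Pi.add_apply]; ring
  map_smul' c w := by
    ext ij; simp only [Pi.smul_apply, smul_eq_mul, RingHom.id_apply]; ring

/-- The tensor `a ^ d ⊗ b` as a linear function of `b`. -/
def veroneseMap (n d : ℕ) (a : Fin 2 → ℂ) :
    (Fin (n + 1) → ℂ) →ₗ[ℂ] (Fin (d + 1) × Fin (n + 1) → ℂ) where
  toFun b := segreVeroneseVec n d a b
  map_add' v w := by ext ij; simp only [segreVeroneseVec, Pi.add_apply]; ring
  map_smul' c w := by
    ext ij; simp only [segreVeroneseVec, Pi.smul_apply, smul_eq_mul, RingHom.id_apply]; ring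

/-- The coordinates of `(a + t a') ^ d` as polynomials in `t`. -/
def veroneseCurve (d : ℕ) (a a' : Fin 2 → ℂ) (i : ℕ) : Polynomial ℂ :=
  (Polynomial.C (a 0) + Polynomial.X * Polynomial.C (a' 0)) ^ (d - i) *
    (Polynomial.C (a 1) + Polynomial.X * Polynomial.C (a' 1)) ^ i

/-- The tensor `d a ^ (d - 1) a' ⊗ b` as a linear function of `b`: the derivative of
`(a + t a') ^ d ⊗ b` at `t = 0`. -/
def derivMap (n d : ℕ) (a a' : Fin 2 → ℂ) :
    (Fin (n + 1) → ℂ) →ₗ[ℂ] (Fin (d + 1) × Fin (n + 1) → ℂ) where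
  toFun b := fun ij => (Polynomial.derivative (veroneseCurve d a a' ij.1)).eval 0 * b ij.2
  map_add' v w := by ext ij; simp only [Pi.add_apply]; ring
  map_smul' c w := by
    ext ij; simp only [Pi.smul_apply, smul_eq_mul, RingHom.id_apply]; ring

lemma veroneseMap_apply (n d : ℕ) (a : Fin 2 → ℂ) (b : Fin (n + 1) → ℂ) :
    veroneseMap n d a b = segreVeroneseVec n d a b := rfl

/-- Contraction with a lowers the degree by one and multiplies a'^d by a determinant; in particular
it kills a^d ⊗ V. -/
lemma crossMap_veroneseMap (n d : ℕ) (a a' : Fin 2 → ℂ) (b : Fin (n + 1) → ℂ) :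
    crossMap n d a (veroneseMap n d a' b) = (a 1 * a' 0 - a 0 * a' 1) • lowerMap n d a' b := by
  ext ⟨i, j⟩
  simp only [crossMap, veroneseMap, segreVeroneseVec, lowerMap, LinearMap.coe_mk, AddHom.coe_mk,
    Pi.smul_apply, smul_eq_mul, Fin.val_castSucc, Fin.val_succ]
  have h1 : d - (i : ℕ) = d - 1 - i + 1 := by omega
  have h2 : d - ((i : ℕ) + 1) = d - 1 - i := by omega
  rw [h1, h2]
  ring

/-- Multiplying the i-th coordinate of (a + t a')^d by the second entry of a + t a' gives the same
as multiplying the next coordinate by the first entry. Differentiating this identity at t = 0 gives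
the formula. -/
lemma crossMap_derivMap (n d : ℕ) (a a' : Fin 2 → ℂ) (b : Fin (n + 1) → ℂ) :
    crossMap n d a (derivMap n d a a' b) = (a' 0 * a 1 - a' 1 * a 0) • lowerMap n d a b := by
  ext ⟨i, j⟩
  have hi : d - (i : ℕ) = d - 1 - i + 1 := by omega
  have hi' : d - ((i : ℕ) + 1) = d - 1 - i := by omega
  have h : (Polynomial.C (a 1) + Polynomial.X * Polynomial.C (a' 1)) * veroneseCurve d a a' i =
      (Polynomial.C (a 0) + Polynomial.X * Polynomial.C (a' 0)) *
        veroneseCurve d a a' (i + 1) := by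
    rw [veroneseCurve, veroneseCurve, hi, hi']
    ring
  have h' := congrArg (fun P => (Polynomial.derivative P).eval 0) h
  have e1 : (veroneseCurve d a a' i).eval 0 = a 0 ^ (d - 1 - (i : ℕ) + 1) * a 1 ^ (i : ℕ) := by
    simp [veroneseCurve, hi]
  have e2 : (veroneseCurve d a a' (i + 1)).eval 0 =
      a 0 ^ (d - 1 - (i : ℕ)) * a 1 ^ ((i : ℕ) + 1) := by
    simp [veroneseCurve, hi']
  simp only [Polynomial.derivative_mul, Polynomial.derivative_add, Polynomial.derivative_C,
    Polynomial.derivative_X, Polynomial.eval_add, Polynomial.eval_mul, Polynomial.eval_C,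
    Polynomial.eval_X, Polynomial.eval_zero, Polynomial.eval_one, e1, e2] at h'
  simp only [crossMap, derivMap, lowerMap, LinearMap.coe_mk, AddHom.coe_mk,
    Pi.smul_apply, smul_eq_mul, Fin.val_castSucc, Fin.val_succ]
  linear_combination b j * h'

lemma apply_zero_ne_zero_or_apply_one_ne_zero {a : Fin 2 → ℂ} (ha : a ≠ 0) : a 0 ≠ 0 ∨ a 1 ≠ 0 := by
  obtain ⟨i, hi⟩ := Function.ne_iff.1 ha
  fin_cases i
  · exact Or.inl hi
  · exact Or.inr hi

/-- The equations form a recursion a₁ w_i = a₀ w_(i+1), solved upwards from w_0 when a₀ ≠ 0 and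
downwards from w_d when a₁ ≠ 0. -/
lemma crossMap_eq_zero {n d : ℕ} {a : Fin 2 → ℂ} (ha : a ≠ 0)
    {w : Fin (d + 1) × Fin (n + 1) → ℂ} (hw : crossMap n d a w = 0) :
    ∃ c, w = veroneseMap n d a c := by
  have hrec : ∀ (i : Fin d) (j : Fin (n + 1)), a 1 * w (i.castSucc, j) = a 0 * w (i.succ, j) :=
    fun i j => sub_eq_zero.1 (congrFun hw (i, j))
  rcases apply_zero_ne_zero_or_apply_one_ne_zero ha with h0 | h1
  · have h : ∀ (i : Fin (d + 1)) (j : Fin (n + 1)),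
        a 0 ^ (i : ℕ) * w (i, j) = a 1 ^ (i : ℕ) * w (0, j) := by
      intro i j
      induction i using Fin.induction with
      | zero => simp
      | succ i ih =>
        simp only [Fin.val_succ, Fin.val_castSucc] at ih ⊢
        linear_combination a 1 * ih - a 0 ^ (i : ℕ) * hrec i j
    refine ⟨fun j => w (0, j) / a 0 ^ d, ?_⟩
    ext ⟨i, j⟩
    have hi : a 0 ^ d = a 0 ^ (d - (i : ℕ)) * a 0 ^ (i : ℕ) := by
      rw [← pow_add, Nat.sub_add_cancel (Nat.lt_succ_iff.1 i.2)]
    simp only [veroneseMap, segreVeroneseVec, LinearMap.coe_mk, AddHom.coe_mk]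
    rw [hi]
    field_simp
    linear_combination h i j
  · have h : ∀ (i : Fin (d + 1)) (j : Fin (n + 1)),
        a 1 ^ (d - (i : ℕ)) * w (i, j) = a 0 ^ (d - (i : ℕ)) * w (Fin.last d, j) := by
      intro i j
      induction i using Fin.reverseInduction with
      | last => simp
      | cast i ih =>
        have e1 : d - (i : ℕ) = d - ((i : ℕ) + 1) + 1 := by omega
        simp only [Fin.val_succ, Fin.val_castSucc] at ih ⊢
        rw [e1]
        linear_combination a 0 * ih + a 1 ^ (d - ((i : ℕ) + 1)) * hrec i j
    refine ⟨fun j => w (Fin.last d, j) / a 1 ^ d, ?_⟩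
    ext ⟨i, j⟩
    have hi : a 1 ^ d = a 1 ^ (d - (i : ℕ)) * a 1 ^ (i : ℕ) := by
      rw [← pow_add, Nat.sub_add_cancel (Nat.lt_succ_iff.1 i.2)]
    simp only [veroneseMap, segreVeroneseVec, LinearMap.coe_mk, AddHom.coe_mk]
    rw [hi]
    field_simp
    linear_combination h i j

lemma exists_pow_mul_pow_ne_zero {d : ℕ} (hd : 1 ≤ d) {a : Fin 2 → ℂ} (ha : a ≠ 0) :
    ∃ i : Fin d, a 0 ^ (d - 1 - (i : ℕ)) * a 1 ^ (i : ℕ) ≠ 0 := by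
  rcases apply_zero_ne_zero_or_apply_one_ne_zero ha with h0 | h1
  · exact ⟨⟨0, hd⟩, by simp [h0]⟩
  · exact ⟨⟨d - 1, by omega⟩, by simp [h1]⟩

lemma lowerMap_injective (n : ℕ) {d : ℕ} (hd : 1 ≤ d) {a : Fin 2 → ℂ} (ha : a ≠ 0) :
    Function.Injective (lowerMap n d a) := by
  refine (injective_iff_map_eq_zero _).2 fun b hb => ?_
  obtain ⟨i, hi⟩ := exists_pow_mul_pow_ne_zero hd ha
  ext j
  exact (mul_eq_zero.1 (congrFun hb (i, j))).resolve_left hi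

lemma veroneseMap_injective (n d : ℕ) {a : Fin 2 → ℂ} (ha : a ≠ 0) :
    Function.Injective (veroneseMap n d a) := by
  refine (injective_iff_map_eq_zero _).2 fun b hb => ?_
  by_contra h
  exact segreVeroneseVec_ne_zero n d ha h hb

/-- With this normalisation, `derivMap` followed by `crossMap` is exactly `lowerMap`. -/
lemma exists_det_eq_one {a : Fin 2 → ℂ} (ha : a ≠ 0) :
    ∃ a' : Fin 2 → ℂ, a' 0 * a 1 - a' 1 * a 0 = 1 := by
  rcases apply_zero_ne_zero_or_apply_one_ne_zero ha with h | h
  · exact ⟨![0, -(a 0)⁻¹], by simp [h]⟩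
  · exact ⟨![(a 1)⁻¹, 0], by simp [h]⟩

/-! ### Tangent spaces of the Segre–Veronese variety -/

lemma eval_eq_zero_of_mem_coneIdeal {n d : ℕ} {F : MvPolynomial (Fin (d + 1) × Fin (n + 1)) ℂ}
    (hF : F ∈ coneIdeal (segreVeronese n d)) {a : Fin 2 → ℂ} {b : Fin (n + 1) → ℂ}
    (ha : a ≠ 0) (hb : b ≠ 0) : MvPolynomial.eval (segreVeroneseVec n d a b) F = 0 :=
  hF _ ⟨segreVeroneseVec_ne_zero n d ha hb, a, b, ha, hb, rfl⟩

lemma segreVeronese_exists_rep {n d : ℕ} {x : ProjSpace (Fin (d + 1) × Fin (n + 1))}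
    (hx : x ∈ segreVeronese n d) :
    ∃ (a : Fin 2 → ℂ) (b : Fin (n + 1) → ℂ), a ≠ 0 ∧ b ≠ 0 ∧ x.rep = veroneseMap n d a b := by
  obtain ⟨a, b, ha, hb, rfl⟩ := hx
  obtain ⟨c, hc, h⟩ := ProjSpace.exists_rep_mk _ (segreVeroneseVec_ne_zero n d ha hb)
  refine ⟨a, c • b, ha, smul_ne_zero hc hb, ?_⟩
  rw [h, map_smul, veroneseMap_apply]

lemma mem_tangentSpaceAt_iff {ι : Type} [Fintype ι] {X : Set (ProjSpace ι)} {x : ProjSpace ι}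
    {w : ι → ℂ} : w ∈ tangentSpaceAt X x ↔ ∀ F ∈ coneIdeal X,
      ∑ i, MvPolynomial.eval x.rep (MvPolynomial.pderiv i F) * w i = 0 := by
  simp [tangentSpaceAt, Submodule.mem_iInf]

/-- The velocity at `t = 0` of a polynomial curve in the cone over `X` is tangent to `X`. -/
lemma derivative_mem_tangentSpaceAt {ι : Type} [Fintype ι] {X : Set (ProjSpace ι)}
    {x : ProjSpace ι} (g : ι → Polynomial ℂ) (hg : ∀ i, (g i).eval 0 = x.rep i)
    {R : Polynomial ℂ} (hR : R ≠ 0)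
    (h : ∀ F ∈ coneIdeal X, ∀ t, R.eval t ≠ 0 →
      MvPolynomial.eval (fun i => (g i).eval t) F = 0) :
    (fun i => (Polynomial.derivative (g i)).eval 0) ∈ tangentSpaceAt X x := by
  refine mem_tangentSpaceAt_iff.2 fun F hF => ?_
  have h0 : R * MvPolynomial.aeval g F = 0 := by
    refine Polynomial.funext fun t => ?_
    rw [Polynomial.eval_mul, Polynomial.eval_zero, eval_aeval_polynomial, mul_eq_zero]
    exact or_iff_not_imp_left.2 (h F hF t)
  replace h0 := (mul_eq_zero.1 h0).resolve_left hR
  have h1 := congrArg (Polynomial.eval 0) (derivative_aeval_polynomial g F)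
  rw [h0, Polynomial.derivative_zero, Polynomial.eval_zero, Polynomial.eval_finsetSum] at h1
  refine Eq.trans ?_ h1.symm
  refine Finset.sum_congr rfl fun i _ => ?_
  rw [Polynomial.eval_mul, eval_aeval_polynomial]
  simp only [hg]

lemma veroneseMap_mem_tangentSpaceAt {n d : ℕ} {x : ProjSpace (Fin (d + 1) × Fin (n + 1))}
    {a : Fin 2 → ℂ} {b : Fin (n + 1) → ℂ} (ha : a ≠ 0) (hb : b ≠ 0)
    (hx : x.rep = veroneseMap n d a b) (c : Fin (n + 1) → ℂ) :
    veroneseMap n d a c ∈ tangentSpaceAt (segreVeronese n d) x := by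
  obtain ⟨j, hj⟩ := Function.ne_iff.1 hb
  have key := derivative_mem_tangentSpaceAt (X := segreVeronese n d) (x := x)
    (fun ij => Polynomial.C (veroneseMap n d a b ij) +
      Polynomial.X * Polynomial.C (veroneseMap n d a c ij)) (by simp [hx])
    -- The curve b + t c may pass through 0; R is its j-th coordinate with b j ≠ 0, so it vanishes
    -- at any such t without being zero as a polynomial.
    (R := Polynomial.C (b j) + Polynomial.X * Polynomial.C (c j)) ?_ ?_
  · simpa using key
  · intro h0
    exact hj (by simpa using congrArg (Polynomial.eval 0) h0)
  · intro F hF t ht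
    have hbt : b + t • c ≠ 0 := by
      intro h0
      exact ht (by simpa [mul_comm t] using congrFun h0 j)
    convert eval_eq_zero_of_mem_coneIdeal hF ha hbt using 3
    rw [← veroneseMap_apply, map_add, map_smul]
    ext ij
    simp [mul_comm t]

lemma derivMap_mem_tangentSpaceAt {n d : ℕ} {x : ProjSpace (Fin (d + 1) × Fin (n + 1))}
    {a a' : Fin 2 → ℂ} {b : Fin (n + 1) → ℂ} (hb : b ≠ 0)
    (hx : x.rep = veroneseMap n d a b) (ha' : a' 0 * a 1 - a' 1 * a 0 ≠ 0) :
    derivMap n d a a' b ∈ tangentSpaceAt (segreVeronese n d) x := by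
  have key := derivative_mem_tangentSpaceAt (X := segreVeronese n d) (x := x)
    (fun ij => veroneseCurve d a a' ij.1 * Polynomial.C (b ij.2))
    (by simp [hx, veroneseMap, veroneseCurve, segreVeroneseVec]) one_ne_zero ?_
  · convert key using 1
    ext ij
    simp [derivMap]
  · intro F hF t _
    have hat : a + t • a' ≠ 0 := by
      intro h0
      have e0 : a 0 + t * a' 0 = 0 := by simpa using congrFun h0 0
      have e1 : a 1 + t * a' 1 = 0 := by simpa using congrFun h0 1
      exact ha' (by linear_combination a' 0 * e1 - a' 1 * e0)
    convert eval_eq_zero_of_mem_coneIdeal hF hat hb using 3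
    ext ij
    simp [veroneseCurve, segreVeroneseVec, mul_comm t]

/-- A quadratic relation among the bihomogeneous monomials of bidegree `(d, 1)`. -/
lemma minor_mem_coneIdeal {n d : ℕ} (i k : Fin d) (j l : Fin (n + 1)) :
    (MvPolynomial.X (i.castSucc, j) * MvPolynomial.X (k.succ, l) -
      MvPolynomial.X (i.succ, j) * MvPolynomial.X (k.castSucc, l) :
        MvPolynomial (Fin (d + 1) × Fin (n + 1)) ℂ) ∈ coneIdeal (segreVeronese n d) := by
  rintro v ⟨hv, a, b, ha, hb, h⟩
  obtain ⟨c, hc⟩ := (Projectivization.mk_eq_mk_iff' ℂ _ _ _ _).1 h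
  have hi : d - (i : ℕ) = d - (i + 1 : ℕ) + 1 := by omega
  have hk : d - (k : ℕ) = d - (k + 1 : ℕ) + 1 := by omega
  simp only [map_sub, map_mul, MvPolynomial.aeval_X, ← hc, Pi.smul_apply, smul_eq_mul,
    segreVeroneseVec, Fin.val_castSucc, Fin.val_succ, hi, hk]
  ring

/-- The differentials at x of the quadrics in `minor_mem_coneIdeal` are the 2 × 2 minors expressing
that the contraction of w is proportional to a^(d-1) ⊗ b, so these quadrics alone bound the tangent
space from above. -/
lemma crossMap_mem_span_of_mem_tangentSpaceAt {n d : ℕ} (hd : 1 ≤ d)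
    {x : ProjSpace (Fin (d + 1) × Fin (n + 1))} {a : Fin 2 → ℂ} {b : Fin (n + 1) → ℂ}
    (ha : a ≠ 0) (hb : b ≠ 0) (hx : x.rep = veroneseMap n d a b)
    {w : Fin (d + 1) × Fin (n + 1) → ℂ} (hw : w ∈ tangentSpaceAt (segreVeronese n d) x) :
    crossMap n d a w ∈ Submodule.span ℂ {lowerMap n d a b} := by
  classical
  obtain ⟨k, hk⟩ := exists_pow_mul_pow_ne_zero hd ha
  obtain ⟨l, hl⟩ := Function.ne_iff.1 hb
  have hkl : lowerMap n d a b (k, l) ≠ 0 := mul_ne_zero hk hl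
  have key : ∀ (i : Fin d) (j : Fin (n + 1)),
      lowerMap n d a b (k, l) * crossMap n d a w (i, j) =
        lowerMap n d a b (i, j) * crossMap n d a w (k, l) := by
    intro i j
    have h := mem_tangentSpaceAt_iff.1 hw _ (minor_mem_coneIdeal i k j l)
    simp only [map_sub, MvPolynomial.pderiv_mul, MvPolynomial.pderiv_X, map_add,
      MvPolynomial.eval_X, hx, sub_mul, add_mul, Finset.sum_sub_distrib, Finset.sum_add_distrib,
      Pi.single_apply, apply_ite (MvPolynomial.eval _), map_zero, ite_mul, mul_ite,
      zero_mul, mul_zero, one_mul, mul_one, Finset.sum_ite_eq,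
      Finset.mem_univ, if_true] at h
    have hi : d - (i : ℕ) = d - 1 - i + 1 := by omega
    have hi' : d - ((i : ℕ) + 1) = d - 1 - i := by omega
    have hk : d - (k : ℕ) = d - 1 - k + 1 := by omega
    have hk' : d - ((k : ℕ) + 1) = d - 1 - k := by omega
    simp only [veroneseMap, segreVeroneseVec, LinearMap.coe_mk, AddHom.coe_mk,
      Fin.val_castSucc, Fin.val_succ, hi, hk, hi', hk'] at h
    simp only [lowerMap, crossMap, LinearMap.coe_mk, AddHom.coe_mk]
    linear_combination h
  refine Submodule.mem_span_singleton.2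
    ⟨crossMap n d a w (k, l) / lowerMap n d a b (k, l), ?_⟩
  ext ⟨i, j⟩
  rw [Pi.smul_apply, smul_eq_mul, div_mul_eq_mul_div, div_eq_iff hkl]
  linear_combination -key i j

/-- The tangent space of the Segre–Veronese variety at `a ^ d ⊗ b` consists of the tensors that
`crossMap n d a` maps to multiples of `a ^ (d - 1) ⊗ b`. -/
theorem tangentSpaceAt_segreVeronese {n d : ℕ} (hd : 1 ≤ d)
    {x : ProjSpace (Fin (d + 1) × Fin (n + 1))} {a : Fin 2 → ℂ} {b : Fin (n + 1) → ℂ}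
    (ha : a ≠ 0) (hb : b ≠ 0) (hx : x.rep = veroneseMap n d a b) :
    tangentSpaceAt (segreVeronese n d) x =
      (Submodule.span ℂ {lowerMap n d a b}).comap (crossMap n d a) := by
  refine le_antisymm
    (fun w hw => crossMap_mem_span_of_mem_tangentSpaceAt hd ha hb hx hw) fun w hw => ?_
  obtain ⟨m, hm⟩ := Submodule.mem_span_singleton.1 (Submodule.mem_comap.1 hw)
  obtain ⟨a', ha'⟩ := exists_det_eq_one ha
  obtain ⟨c, hc⟩ := crossMap_eq_zero ha (w := w - m • derivMap n d a a' b) (by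
    rw [map_sub, map_smul, crossMap_derivMap, ha', one_smul, hm, sub_self])
  rw [sub_eq_iff_eq_add.1 hc]
  exact Submodule.add_mem _ (veroneseMap_mem_tangentSpaceAt ha hb hx c)
    (Submodule.smul_mem _ _ (derivMap_mem_tangentSpaceAt hb hx (by rw [ha']; exact one_ne_zero)))

/-! ### General linear subspaces containing T -/

/-- A linear subspace containing `T` of finite dimension is spanned by `T` and a frame. -/
lemma exists_sup_span_eq {V : Type*} [AddCommGroup V] [Module ℂ V] [FiniteDimensional ℂ V]
    {T L : Submodule ℂ V} (h : T ≤ L) {m : ℕ} (hm : m = Module.finrank ℂ L - Module.finrank ℂ T) :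
    ∃ v : Fin m → V, T ⊔ Submodule.span ℂ (Set.range v) = L := by
  obtain ⟨K, hK⟩ := T.exists_isCompl
  have hsup : T ⊔ K ⊓ L = L := by
    rw [← sup_inf_assoc_of_le K h, hK.sup_eq_top, top_inf_eq]
  have hinf : T ⊓ (K ⊓ L) = ⊥ := by
    rw [← inf_assoc, hK.inf_eq_bot, bot_inf_eq]
  have hrank : Module.finrank ℂ ↥(K ⊓ L) = m := by
    have := Submodule.finrank_sup_add_finrank_inf_eq T (K ⊓ L)
    rw [hsup, hinf, finrank_bot] at this
    omega
  let B := Module.finBasisOfFinrankEq ℂ ↥(K ⊓ L) hrank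
  refine ⟨fun k => (B k : V), ?_⟩
  have hB : Submodule.span ℂ (Set.range fun k => (B k : V)) = K ⊓ L := by
    have := congrArg (Submodule.map (K ⊓ L).subtype) B.span_eq
    rwa [Submodule.map_span, ← Set.range_comp, Submodule.map_top, Submodule.range_subtype] at this
  rw [hB, hsup]

lemma exists_submodule_finrank_eq {V : Type*} [AddCommGroup V] [Module ℂ V]
    [FiniteDimensional ℂ V] (T : Submodule ℂ V) {k : ℕ}
    (h : Module.finrank ℂ T ≤ k) (hk : k ≤ Module.finrank ℂ V) :
    ∃ L : Submodule ℂ V, T ≤ L ∧ Module.finrank ℂ L = k := by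
  induction k, h using Nat.le_induction with
  | base => exact ⟨T, le_rfl, rfl⟩
  | succ k _ ih =>
    obtain ⟨L, hTL, hL⟩ := ih (by omega)
    obtain ⟨v, hv⟩ : ∃ v, v ∉ L := by
      by_contra! hall
      rw [(Submodule.eq_top_iff'.2 hall), finrank_top] at hL
      omega
    refine ⟨L ⊔ Submodule.span ℂ {v}, hTL.trans le_sup_left, ?_⟩
    rw [Submodule.finrank_sup_span_singleton hv, hL]

lemma exists_linearMap_le_ker {V : Type*} [AddCommGroup V] [Module ℂ V] [FiniteDimensional ℂ V]
    (M : Submodule ℂ V) {m : ℕ} (hm : m + Module.finrank ℂ M ≤ Module.finrank ℂ V) :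
    ∃ f : V →ₗ[ℂ] (Fin m → ℂ), M ≤ LinearMap.ker f ∧ Function.Surjective f := by
  have hq := M.finrank_quotient_add_finrank
  let B := Module.finBasis ℂ (V ⧸ M)
  have hle : m ≤ Module.finrank ℂ (V ⧸ M) := by omega
  refine ⟨(LinearMap.funLeft ℂ ℂ (Fin.castLE hle)).comp
    (B.equivFun.toLinearMap.comp M.mkQ), fun v hv => ?_, ?_⟩
  · have hv0 : M.mkQ v = 0 := (Submodule.Quotient.mk_eq_zero M).2 hv
    rw [LinearMap.mem_ker, LinearMap.comp_apply, LinearMap.comp_apply, hv0, map_zero, map_zero]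
  · exact (LinearMap.funLeft_surjective_of_injective ℂ ℂ _ (Fin.castLE_injective hle)).comp
      (B.equivFun.surjective.comp M.mkQ_surjective)

/-- A frame whose images under `f` are independent spans a complement of `ker f`. -/
lemma sup_span_of_det_ne_zero {V : Type*} [AddCommGroup V] [Module ℂ V] [FiniteDimensional ℂ V]
    {T : Submodule ℂ V} {m : ℕ} {f : V →ₗ[ℂ] (Fin m → ℂ)} (hT : T ≤ LinearMap.ker f)
    {v : Fin m → V} (hv : (Matrix.of fun k => f (v k)).det ≠ 0) :
    (T ⊔ Submodule.span ℂ (Set.range v)) ⊓ LinearMap.ker f ≤ T ∧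
      Module.finrank ℂ ↥(T ⊔ Submodule.span ℂ (Set.range v)) = Module.finrank ℂ T + m := by
  have hli : LinearIndependent ℂ (fun k => f (v k)) :=
    Matrix.linearIndependent_rows_of_det_ne_zero hv
  have hzero : ∀ w ∈ Submodule.span ℂ (Set.range v), f w = 0 → w = 0 := by
    intro w hw hfw
    obtain ⟨c, rfl⟩ := (Submodule.mem_span_range_iff_exists_fun ℂ).1 hw
    rw [map_sum] at hfw
    simp only [map_smul] at hfw
    have := Fintype.linearIndependent_iff.1 hli c hfw
    simp [this]
  constructor
  · rintro w ⟨hw, hfw⟩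
    obtain ⟨y, hy, z, hz, rfl⟩ := Submodule.mem_sup.1 hw
    have hfz : f z = 0 := by
      have : f (y + z) = 0 := hfw
      rwa [map_add, LinearMap.mem_ker.1 (hT hy), zero_add] at this
    rwa [hzero z hz hfz, add_zero]
  · have hinf : T ⊓ Submodule.span ℂ (Set.range v) = ⊥ := by
      rw [eq_bot_iff]
      rintro w ⟨hwT, hw⟩
      exact hzero w hw (hT hwT)
    have := Submodule.finrank_sup_add_finrank_inf_eq T (Submodule.span ℂ (Set.range v))
    rwa [hinf, finrank_bot, add_zero, finrank_span_eq_card (hli.of_comp f), Fintype.card_fin]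
      at this

/-- The determinant of the images of a frame under a linear map, as a polynomial. -/
lemma exists_polynomial_eval_eq_det {ι : Type} [Fintype ι] {m : ℕ}
    (f : (ι → ℂ) →ₗ[ℂ] (Fin m → ℂ)) :
    ∃ P : MvPolynomial (Fin m × ι) ℂ, ∀ v : Fin m × ι → ℂ,
      MvPolynomial.eval v P = (Matrix.of fun k => f (fun i => v (k, i))).det := by
  classical
  refine ⟨(Matrix.of fun k l : Fin m => ∑ i, MvPolynomial.C (f (Pi.single i 1) l) *
    (MvPolynomial.X (k, i) : MvPolynomial (Fin m × ι) ℂ)).det, fun v => ?_⟩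
  rw [RingHom.map_det]
  congr 1
  ext k l
  simp only [RingHom.mapMatrix_apply, Matrix.map_apply, Matrix.of_apply, map_sum, map_mul,
    MvPolynomial.eval_C, MvPolynomial.eval_X]
  conv_rhs => rw [← LinearMap.sum_single_apply (fun _ => ℂ) (fun i => v (k, i)), map_sum]
  rw [Finset.sum_apply]
  refine Finset.sum_congr rfl fun i _ => ?_
  have : (Pi.single i (v (k, i)) : ι → ℂ) = v (k, i) • Pi.single i 1 := by
    rw [← Pi.single_smul, smul_eq_mul, mul_one]
  rw [this, map_smul, Pi.smul_apply, smul_eq_mul, mul_comm]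

/-- A general linear subspace that contains `T` meets `M ⊇ T` only in `T`, if the dimensions allow
it. -/
theorem exists_mem_inf_le {ι : Type} [Fintype ι] {T M : Submodule ℂ (ι → ℂ)} (hTM : T ≤ M) {s : ℕ}
    (hdim : s + 1 - Module.finrank ℂ T + Module.finrank ℂ M ≤ Fintype.card ι)
    {W : Set (SubspacesContaining T s)} (hW : IsOpen W) (hne : W.Nonempty) :
    ∃ L ∈ W, L.1 ⊓ M ≤ T := by
  obtain ⟨⟨L₀, hTL₀, hL₀⟩, hL₀W⟩ := hne
  -- Nonemptiness of W rules out truncation in s + 1 - dim T.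
  have hTs : Module.finrank ℂ T ≤ s + 1 := hL₀ ▸ Submodule.finrank_mono hTL₀
  obtain ⟨v₀, rfl⟩ := exists_sup_span_eq (m := s + 1 - Module.finrank ℂ T) hTL₀ (by rw [hL₀])
  obtain ⟨O, hO, hOW⟩ := isOpen_induced_iff.1 (isOpen_coinduced.1 hW)
  obtain ⟨F, hF, hFO⟩ := AffSpace.exists_polynomial_of_mem
    (v := fun ki : Fin (s + 1 - Module.finrank ℂ T) × ι => v₀ ki.1 ki.2) hO
    ((Set.ext_iff.1 hOW ⟨fun ki => v₀ ki.1 ki.2, hL₀⟩).2 hL₀W)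
  obtain ⟨f, hfM, hf⟩ := exists_linearMap_le_ker M (m := s + 1 - Module.finrank ℂ T)
    (by rwa [Module.finrank_fintype_fun_eq_card])
  obtain ⟨P, hP⟩ := exists_polynomial_eval_eq_det f
  -- F keeps the frame inside W and P makes it transversal to the kernel of f; both are nonzero, so
  -- they are simultaneously nonzero at some frame.
  obtain ⟨v, hv⟩ : ∃ v, MvPolynomial.eval v (F * P) ≠ 0 := by
    by_contra! h0
    have h1 : F * P = 0 := MvPolynomial.funext (by simpa using h0)
    rcases mul_eq_zero.1 h1 with rfl | rfl
    · exact hF (map_zero _)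
    -- P is nonzero: preimages under f of the standard basis form a frame with determinant 1.
    · choose e he using hf
      have := hP fun ki => e (Pi.single ki.1 1) ki.2
      simp only [map_zero] at this
      rw [eq_comm] at this
      refine one_ne_zero (α := ℂ) (Eq.trans (Eq.trans
        (Matrix.det_one (n := Fin (s + 1 - Module.finrank ℂ T)) (R := ℂ)).symm ?_) this)
      congr 1
      ext k l
      rw [Matrix.of_apply, he, Matrix.one_apply, Pi.single_apply]
      simp only [eq_comm]
  rw [map_mul] at hv
  have hvP := right_ne_zero_of_mul hv
  rw [hP] at hvP
  obtain ⟨hinf, hrank⟩ := sup_span_of_det_ne_zero (hTM.trans hfM) hvP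
  rw [Nat.add_sub_cancel' hTs] at hrank
  exact ⟨⟨_, le_sup_left, hrank⟩, (Set.ext_iff.1 hOW ⟨v, hrank⟩).1
    (hFO v (left_ne_zero_of_mul hv)), (inf_le_inf_left _ hfM).trans hinf⟩

/-! ### Dimensions of T and M, and the fibres inside a proper subspace -/

/-- The preimage is the direct sum of a^d ⊗ V and a copy of S embedded by `derivMap`. Taking S = ⟨b⟩
gives T, and S = V gives M. -/
lemma finrank_comap_crossMap (n : ℕ) {d : ℕ} (hd : 1 ≤ d) {a : Fin 2 → ℂ} (ha : a ≠ 0)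
    (S : Submodule ℂ (Fin (n + 1) → ℂ)) :
    Module.finrank ℂ ↥((S.map (lowerMap n d a)).comap (crossMap n d a)) =
      n + 1 + Module.finrank ℂ S := by
  obtain ⟨a', ha'⟩ := exists_det_eq_one ha
  have hv : ∀ c, crossMap n d a (veroneseMap n d a c) = 0 := fun c => by
    rw [crossMap_veroneseMap, mul_comm, sub_self, zero_smul]
  have hδ : ∀ c, crossMap n d a (derivMap n d a a' c) = lowerMap n d a c := fun c => by
    rw [crossMap_derivMap, ha', one_smul]
  let J : (Fin (n + 1) → ℂ) × S →ₗ[ℂ] (Fin (d + 1) × Fin (n + 1) → ℂ) :=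
    (veroneseMap n d a).coprod ((derivMap n d a a').comp S.subtype)
  have hJ : ∀ p, J p = veroneseMap n d a p.1 + derivMap n d a a' p.2 := fun p => rfl
  have hinj : Function.Injective J := by
    refine (injective_iff_map_eq_zero _).2 fun p hp => ?_
    rw [hJ] at hp
    have h2 : p.2 = 0 := by
      have h := congrArg (crossMap n d a) hp
      rw [map_add, hv, hδ, zero_add, map_zero] at h
      exact Subtype.ext ((injective_iff_map_eq_zero _).1 (lowerMap_injective n hd ha) _ h)
    rw [h2, Submodule.coe_zero, map_zero, add_zero] at hp
    exact Prod.ext ((injective_iff_map_eq_zero _).1 (veroneseMap_injective n d ha) _ hp) h2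
  have hrange : LinearMap.range J = (S.map (lowerMap n d a)).comap (crossMap n d a) := by
    refine le_antisymm ?_ ?_
    · rintro _ ⟨p, rfl⟩
      refine ⟨p.2, p.2.2, ?_⟩
      rw [hJ, map_add, hv, hδ, zero_add]
    · rintro w ⟨b, hb, hbw⟩
      obtain ⟨c, hc⟩ := crossMap_eq_zero ha (w := w - derivMap n d a a' b)
        (by rw [map_sub, hδ, hbw, sub_self])
      exact ⟨(c, ⟨b, hb⟩), by rw [hJ, ← hc, sub_add_cancel]⟩
  rw [← hrange, LinearMap.finrank_range_of_inj hinj, Module.finrank_prod,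
    Module.finrank_fintype_fun_eq_card, Fintype.card_fin]

lemma exists_smul_eq_of_det_eq_zero {a a' : Fin 2 → ℂ} (ha : a ≠ 0) (ha' : a' ≠ 0)
    (h : a' 1 * a 0 - a' 0 * a 1 = 0) : ∃ c : ℂ, c ≠ 0 ∧ a' = c • a := by
  have key : ∃ c : ℂ, a' = c • a := by
    rcases apply_zero_ne_zero_or_apply_one_ne_zero ha with h0 | h1
    · refine ⟨a' 0 / a 0, ?_⟩
      ext i
      fin_cases i
      · simp [h0]
      · simp only [Fin.mk_one, Pi.smul_apply, smul_eq_mul]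
        field_simp
        linear_combination h
    · refine ⟨a' 1 / a 1, ?_⟩
      ext i
      fin_cases i
      · simp only [Fin.zero_eta, Pi.smul_apply, smul_eq_mul]
        field_simp
        linear_combination -h
      · simp [h1]
  obtain ⟨c, hc⟩ := key
  refine ⟨c, ?_, hc⟩
  rintro rfl
  exact ha' (by rw [hc, zero_smul])

lemma veroneseMap_smul (n d : ℕ) (c : ℂ) (a : Fin 2 → ℂ) (b : Fin (n + 1) → ℂ) :
    veroneseMap n d (c • a) b = veroneseMap n d a (c ^ d • b) := by
  ext ⟨i, j⟩
  have hi : c ^ d = c ^ (d - (i : ℕ)) * c ^ (i : ℕ) := by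
    rw [← pow_add, Nat.sub_add_cancel (Nat.lt_succ_iff.1 i.2)]
  simp only [veroneseMap, segreVeroneseVec, LinearMap.coe_mk, AddHom.coe_mk, Pi.smul_apply,
    smul_eq_mul, hi]
  ring

/-- A proper linear subspace contains only finitely many of the fibres `a ^ d ⊗ V`. -/
lemma exists_finite_of_range_veroneseMap_le {n d : ℕ}
    {L : Submodule ℂ (Fin (d + 1) × Fin (n + 1) → ℂ)} (hL : L ≠ ⊤) :
    ∃ R : Set (Fin 2 → ℂ), R.Finite ∧ ∀ a : Fin 2 → ℂ, a ≠ 0 →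
      LinearMap.range (veroneseMap n d a) ≤ L →
      ∃ r ∈ R, LinearMap.range (veroneseMap n d a) = LinearMap.range (veroneseMap n d r) := by
  classical
  obtain ⟨l, hl0, hl⟩ := Submodule.exists_le_ker_of_lt_top L (lt_top_iff_ne_top.2 hL)
  obtain ⟨⟨i₀, j₀⟩, hij⟩ : ∃ ij, l (Pi.single ij 1) ≠ 0 := by
    by_contra! h
    exact hl0 (LinearMap.pi_ext' fun ij => LinearMap.ext_ring (h ij))
  -- P(t) is the value of l on (1, t)^d ⊗ e_(j₀), so its roots contain every t whose fibre lies in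
  -- L.
  let P : Polynomial ℂ :=
    ∑ i : Fin (d + 1), Polynomial.monomial (i : ℕ) (l (Pi.single (i, j₀) 1))
  have hP : P ≠ 0 := by
    intro h
    have := congrArg (fun p => Polynomial.coeff p i₀) h
    simp only [P, Polynomial.finsetSum_coeff, Polynomial.coeff_monomial, Polynomial.coeff_zero,
      Fin.val_inj, Finset.sum_ite_eq', Finset.mem_univ, if_true] at this
    exact hij this
  have hrange : ∀ (c : ℂ) (a r : Fin 2 → ℂ), c ≠ 0 → a = c • r →
      LinearMap.range (veroneseMap n d a) = LinearMap.range (veroneseMap n d r) := by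
    rintro c _ r hc rfl
    refine le_antisymm ?_ ?_
    · rintro _ ⟨b, rfl⟩
      exact ⟨_, (veroneseMap_smul n d c r b).symm⟩
    · rintro _ ⟨b, rfl⟩
      exact ⟨(c ^ d)⁻¹ • b, by rw [veroneseMap_smul, smul_inv_smul₀ (pow_ne_zero d hc)]⟩
  -- The point ![0, 1] is the one missed by the chart (1, t).
  refine ⟨insert ![0, 1] ((fun t => ![1, t]) '' (P.roots.toFinset : Set ℂ)),
    ((Finset.finite_toSet _).image _).insert _, fun a ha haL => ?_⟩
  by_cases h0 : a 0 = 0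
  · have h1 := (apply_zero_ne_zero_or_apply_one_ne_zero ha).resolve_left (not_not.2 h0)
    refine ⟨_, Set.mem_insert _ _, hrange (a 1) _ _ h1 ?_⟩
    ext i
    fin_cases i <;> simp [h0]
  · have hscale : a = a 0 • ![1, a 1 / a 0] := by
      ext i
      fin_cases i
      · simp
      · simp [mul_div_cancel₀, h0]
    have hr := hrange (a 0) _ _ h0 hscale
    refine ⟨_, Set.mem_insert_of_mem _ ⟨a 1 / a 0, ?_, rfl⟩, hr⟩
    rw [Finset.mem_coe, Multiset.mem_toFinset, Polynomial.mem_roots hP, Polynomial.IsRoot]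
    have hmem : l (veroneseMap n d ![1, a 1 / a 0] (Pi.single j₀ 1)) = 0 :=
      hl (haL (hr ▸ ⟨_, rfl⟩))
    have hexp : veroneseMap n d ![1, a 1 / a 0] (Pi.single j₀ 1) =
        ∑ i : Fin (d + 1), (a 1 / a 0) ^ (i : ℕ) • (Pi.single (i, j₀) 1) := by
      ext ⟨i, j⟩
      simp only [veroneseMap, segreVeroneseVec, LinearMap.coe_mk, AddHom.coe_mk, Finset.sum_apply,
        Pi.smul_apply, smul_eq_mul, Pi.single_apply, Prod.mk.injEq]
      by_cases hj : j = j₀ <;> simp [hj]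
    rw [hexp, map_sum] at hmem
    rw [← hmem, Polynomial.eval_finsetSum]
    refine Finset.sum_congr rfl fun i _ => ?_
    rw [Polynomial.eval_monomial, map_smul, smul_eq_mul, mul_comm]

/-! ### Contact loci on the Segre–Veronese variety -/

/-- A linear subspace `L` that meets the span `M` of the tangent spaces along a fibre only in the
tangent space at `x` has contact locus `{x}`. -/
theorem contactLocus_segreVeronese_subsingleton {n d : ℕ} (hn : 1 ≤ n) (hd : 1 ≤ d)
    (x : ProjTuple 1 (Fin (d + 1) × Fin (n + 1))) {a : Fin 2 → ℂ} {b : Fin (n + 1) → ℂ}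
    (ha : a ≠ 0) (hb : b ≠ 0) (hx : (x 0).rep = veroneseMap n d a b)
    {L : Submodule ℂ (Fin (d + 1) × Fin (n + 1) → ℂ)}
    (hL : L ⊓ (Submodule.map (lowerMap n d a) ⊤).comap (crossMap n d a) ≤
      tangentSpaceAt (segreVeronese n d) (x 0)) :
    (contactLocus (segreVeronese n d) x L).Subsingleton := by
  obtain ⟨a', ha'⟩ := exists_det_eq_one ha
  have hT := tangentSpaceAt_segreVeronese hd ha hb hx
  have key : ∀ c, derivMap n d a a' c ∈ L → c ∈ Submodule.span ℂ {b} := by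
    intro c hc
    have hδ : crossMap n d a (derivMap n d a a' c) = lowerMap n d a c := by
      rw [crossMap_derivMap, ha', one_smul]
    have h := hL ⟨hc, c, trivial, hδ.symm⟩
    rw [hT, Submodule.mem_comap, hδ] at h
    obtain ⟨m, hm⟩ := Submodule.mem_span_singleton.1 h
    rw [← map_smul] at hm
    exact Submodule.mem_span_singleton.2 ⟨m, lowerMap_injective n hd ha hm⟩
  have hLtop : L ≠ ⊤ := by
    rintro rfl
    have h1 : Submodule.span ℂ {b} = ⊤ := Submodule.eq_top_iff'.2 fun c => key c trivial
    have h2 := finrank_span_singleton (K := ℂ) hb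
    rw [h1, finrank_top, Module.finrank_fintype_fun_eq_card, Fintype.card_fin] at h2
    omega
  obtain ⟨R, hR, hRL⟩ := exists_finite_of_range_veroneseMap_le hLtop
  -- The closed set is the union of the finitely many candidate fibres other than the one through x.
  refine contactLocus_subsingleton x L
    (⋃ r ∈ R ∩ {r | (x 0).rep ∉ LinearMap.range (veroneseMap n d r)},
      {z | z.rep ∈ LinearMap.range (veroneseMap n d r)})
    ((hR.inter_of_left _).isClosed_biUnion fun r _ => ProjSpace.isClosed_rep_mem _) ?_ ?_
  · intro h
    obtain ⟨r, hr, hxr⟩ := Set.mem_iUnion₂.1 h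
    exact hr.2 hxr
  · rintro q ⟨hqX, hqL⟩
    obtain ⟨α, β, hα, hβ, hq⟩ := segreVeronese_exists_rep hqX
    by_cases hxα : (x 0).rep ∈ LinearMap.range (veroneseMap n d α)
    · left
      -- Contracting with α kills the α-side and leaves a determinant times the nonzero tensor
      -- a^(d-1) ⊗ b.
      have hdet : α 1 * a 0 - α 0 * a 1 = 0 := by
        obtain ⟨c, hc⟩ := hxα
        have h := congrArg (crossMap n d α) (hc.trans hx)
        rw [crossMap_veroneseMap, crossMap_veroneseMap, mul_comm, sub_self, zero_smul] at h
        refine (smul_eq_zero.1 h.symm).resolve_right fun h0 => hb ?_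
        exact (injective_iff_map_eq_zero _).1 (lowerMap_injective n hd ha) _ h0
      obtain ⟨c, hc, rfl⟩ := exists_smul_eq_of_det_eq_zero ha hα hdet
      rw [veroneseMap_smul] at hq
      have hβ' : c ^ d • β ≠ 0 := smul_ne_zero (pow_ne_zero d hc) hβ
      obtain ⟨m, hm⟩ := Submodule.mem_span_singleton.1 (key _ (hqL
        (derivMap_mem_tangentSpaceAt hβ' hq (a' := a') (by rw [ha']; exact one_ne_zero))))
      refine ProjSpace.eq_of_rep_mem_span (Submodule.mem_span_singleton.2 ⟨m, ?_⟩)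
      rw [hx, hq, ← hm, map_smul]
    · right
      obtain ⟨r, hr, hrα⟩ := hRL α hα (by
        rintro _ ⟨c, rfl⟩
        exact hqL (veroneseMap_mem_tangentSpaceAt hα hβ hq c))
      exact Set.mem_iUnion₂.2 ⟨r, ⟨hr, fun h => hxα (hrα ▸ h)⟩,
        show q.rep ∈ LinearMap.range (veroneseMap n d r) from hrα ▸ ⟨β, hq.symm⟩⟩

/-- If `L` contains the tangent space at `x` and meets the span of the tangent spaces along the
fibre of `x` in more than that, then the contact locus contains a line through `x`. -/
theorem contactLocus_segreVeronese_krullDim_pos {n d : ℕ} (hd : 1 ≤ d)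
    (x : ProjTuple 1 (Fin (d + 1) × Fin (n + 1))) {a : Fin 2 → ℂ} {b : Fin (n + 1) → ℂ}
    (ha : a ≠ 0) (hb : b ≠ 0) (hx : (x 0).rep = veroneseMap n d a b)
    {L : Submodule ℂ (Fin (d + 1) × Fin (n + 1) → ℂ)}
    (hTL : tangentSpaceAt (segreVeronese n d) (x 0) ≤ L)
    (hL : ¬ L ⊓ (Submodule.map (lowerMap n d a) ⊤).comap (crossMap n d a) ≤
      tangentSpaceAt (segreVeronese n d) (x 0)) :
    0 < topologicalKrullDim ↥(contactLocus (segreVeronese n d) x L) := by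
  obtain ⟨w, ⟨hwL, b', -, hwb⟩, hwT⟩ := SetLike.not_le_iff_exists.1 hL
  obtain ⟨a', ha'⟩ := exists_det_eq_one ha
  rw [tangentSpaceAt_segreVeronese hd ha hb hx, Submodule.mem_comap, ← hwb] at hwT
  have hb' : ∀ m : ℂ, m • b ≠ b' := fun m hm =>
    hwT (Submodule.mem_span_singleton.2 ⟨m, by rw [← map_smul, hm]⟩)
  have hne : ∀ t : ℂ, b + t • b' ≠ 0 := by
    intro t ht
    have ht0 : t ≠ 0 := by
      rintro rfl
      exact hb (by simpa using ht)
    apply hb' (-t⁻¹)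
    rw [eq_neg_of_add_eq_zero_left ht, smul_neg, neg_smul, neg_neg, inv_smul_smul₀ ht0]
  have hline : ∀ t : ℂ, veroneseMap n d a b + t • veroneseMap n d a b' =
      veroneseMap n d a (b + t • b') := fun t => by rw [map_add, map_smul]
  have hne' : ∀ t : ℂ, veroneseMap n d a b + t • veroneseMap n d a b' ≠ 0 := fun t => by
    rw [hline]
    exact segreVeroneseVec_ne_zero n d ha (hne t)
  refine contactLocus_krullDim_pos x L (k := 0) (ProjSpace.isIrreducible_line _ _ hne') ?_ ?_ ?_
  · refine ⟨_, ⟨1, rfl⟩, _, ⟨0, rfl⟩, fun h => ?_⟩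
    obtain ⟨c, hc⟩ := (Projectivization.mk_eq_mk_iff' ℂ _ _ _ _).1 h
    rw [hline, hline, ← map_smul] at hc
    have hc' := veroneseMap_injective n d ha hc
    rw [zero_smul, add_zero, one_smul] at hc'
    apply hb' (c - 1)
    rw [sub_smul, one_smul, hc', add_sub_cancel_left]
  · rintro _ ⟨t, rfl⟩
    have hmem : ProjSpace.mk _ (hne' t) ∈ segreVeronese n d :=
      ⟨a, b + t • b', ha, hne t, by congr 1; exact hline t⟩
    refine ⟨hmem, ?_⟩
    obtain ⟨c, hc, hrep⟩ := ProjSpace.exists_rep_mk _ (hne' t)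
    rw [tangentSpaceAt_segreVeronese hd ha (smul_ne_zero hc (hne t))
      (hrep.trans (by rw [hline, ← map_smul]))]
    intro v hv
    obtain ⟨m, hm⟩ := Submodule.mem_span_singleton.1 (Submodule.mem_comap.1 hv)
    -- Both v and a multiple of `derivMap n d a a' b + t • w` contract to the same multiple of
    -- a^(d-1) ⊗ (b + t b'), so they differ by an element of a^d ⊗ V, which lies in T and hence in
    -- L.
    obtain ⟨e, he⟩ := crossMap_eq_zero ha
      (w := v - m • c • (derivMap n d a a' b + t • w)) (by
        rw [map_sub, map_smul, map_smul, map_add, map_smul, crossMap_derivMap, ha', one_smul,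
          ← hwb, ← hm, map_smul, map_add, map_smul, sub_self])
    rw [sub_eq_iff_eq_add.1 he]
    refine L.add_mem (hTL (veroneseMap_mem_tangentSpaceAt ha hb hx e))
      (L.smul_mem _ (L.smul_mem _ (L.add_mem (hTL ?_) (L.smul_mem _ hwL))))
    exact derivMap_mem_tangentSpaceAt hb hx (by rw [ha']; exact one_ne_zero)
  · refine ⟨0, ?_⟩
    refine Eq.trans (ProjSpace.mk_eq_mk_of_smul _ (x 0).rep_ne_zero (c := 1) ?_) (x 0).mk_rep
    rw [hx, zero_smul, add_zero, one_smul]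

lemma tangentSpan_one {ι : Type} [Fintype ι] (X : Set (ProjSpace ι)) (x : ProjTuple 1 ι) :
    tangentSpan X x = tangentSpaceAt X (x 0) :=
  iSup_unique fun k : Fin 1 => tangentSpaceAt X (x k)

end

/-! ### The dimension count -/

theorem mainTheorem4 (n d s : ℕ) (hn : 1 ≤ n) (hd : 1 ≤ d)
    (hs : s < (d + 1) * (n + 1)) :
    ¬ IsTangentiallyWeaklyDefective (segreVeronese n d) 1 s ↔ s ≤ d * (n + 1) := by
  have hmul : (d + 1) * (n + 1) = d * (n + 1) + (n + 1) := by ring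
  have hcard : Fintype.card (Fin (d + 1) × Fin (n + 1)) = d * (n + 1) + (n + 1) := by
    rw [Fintype.card_prod, Fintype.card_fin, Fintype.card_fin, hmul]
  have hle : n + 1 ≤ d * (n + 1) := Nat.le_mul_of_pos_left _ hd
  have hM : ∀ a : Fin 2 → ℂ, a ≠ 0 → Module.finrank ℂ
      ↥((Submodule.map (lowerMap n d a) ⊤).comap (crossMap n d a)) = 2 * (n + 1) := by
    intro a ha
    rw [finrank_comap_crossMap n hd ha, finrank_top, Module.finrank_fintype_fun_eq_card,
      Fintype.card_fin, two_mul]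
  have hT : ∀ (x : ProjSpace (Fin (d + 1) × Fin (n + 1))) (a : Fin 2 → ℂ) (b : Fin (n + 1) → ℂ),
      a ≠ 0 → b ≠ 0 → x.rep = veroneseMap n d a b →
      Module.finrank ℂ ↥(tangentSpaceAt (segreVeronese n d) x) = n + 2 ∧
      tangentSpaceAt (segreVeronese n d) x ≤
        (Submodule.map (lowerMap n d a) ⊤).comap (crossMap n d a) := by
    intro x a b ha hb hx
    have hspan : Submodule.span ℂ {lowerMap n d a b} =
        (Submodule.span ℂ {b}).map (lowerMap n d a) := by
      rw [Submodule.map_span, Set.image_singleton]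
    rw [tangentSpaceAt_segreVeronese hd ha hb hx, hspan]
    refine ⟨?_, Submodule.comap_mono (Submodule.map_mono le_top)⟩
    rw [finrank_comap_crossMap n hd ha, finrank_span_singleton hb]
  constructor
  · intro h
    by_contra! hs'
    -- Above the bound no genericity is needed: every point and every L give a positive-dimensional
    -- contact locus.
    refine h ⟨Set.univ, isOpen_univ, ?_, ?_⟩
    · have h1 : (fun _ => 1 : Fin 2 → ℂ) ≠ 0 := fun h => one_ne_zero (congrFun h 0)
      have h2 : (fun _ => 1 : Fin (n + 1) → ℂ) ≠ 0 := fun h => one_ne_zero (congrFun h 0)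
      exact ⟨⟨fun _ => ProjSpace.mk _ (segreVeroneseVec_ne_zero n d h1 h2),
        fun _ => ⟨_, _, h1, h2, rfl⟩⟩, trivial⟩
    · rintro ⟨x, hxX⟩ -
      obtain ⟨a, b, ha, hb, hx⟩ := segreVeronese_exists_rep (hxX 0)
      obtain ⟨hTrank, hTM⟩ := hT _ a b ha hb hx
      refine ⟨Set.univ, isOpen_univ, ?_, ?_⟩
      · obtain ⟨L, hL⟩ := exists_submodule_finrank_eq (tangentSpan (segreVeronese n d) x)
          (k := s + 1) (by rw [tangentSpan_one, hTrank]; omega)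
          (by rw [Module.finrank_fintype_fun_eq_card, hcard]; omega)
        exact ⟨⟨L, hL⟩, trivial⟩
      · rintro ⟨L, hTL, hLs⟩ -
        rw [tangentSpan_one] at hTL
        refine contactLocus_segreVeronese_krullDim_pos (L := L) hd x ha hb hx hTL fun hinf => ?_
        -- Since s ≥ d(n + 1) + 1, Grassmann's formula gives dim (L ∩ M) ≥ n + 3, more than dim T =
        -- n + 2.
        have h1 := Submodule.finrank_mono hinf
        have h2 := Submodule.finrank_sup_add_finrank_inf_eq L
          ((Submodule.map (lowerMap n d a) ⊤).comap (crossMap n d a))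
        have h3 := Submodule.finrank_le
          (L ⊔ (Submodule.map (lowerMap n d a) ⊤).comap (crossMap n d a))
        rw [Module.finrank_fintype_fun_eq_card, hcard] at h3
        rw [hM a ha, hLs] at h2
        rw [hTrank] at h1
        omega
  · rintro hs' ⟨U, -, ⟨⟨x, hxX⟩, hxU⟩, hU⟩
    obtain ⟨W, hW, hWne, hWpos⟩ := hU _ hxU
    obtain ⟨a, b, ha, hb, hx⟩ := segreVeronese_exists_rep (hxX 0)
    obtain ⟨hTrank, hTM⟩ := hT _ a b ha hb hx
    -- A single L in W with L ∩ M ≤ T contradicts positivity on W. If s + 1 < n + 2 no L exists, and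
    -- the nonemptiness of W is already contradictory.
    obtain ⟨L, hLW, hL⟩ := exists_mem_inf_le
      (M := (Submodule.map (lowerMap n d a) ⊤).comap (crossMap n d a))
      ((tangentSpan_one _ x).trans_le hTM)
      (by
        rw [tangentSpan_one, hTrank, hM a ha, hcard]
        omega) hW hWne
    exact not_topologicalKrullDim_pos_of_subsingleton
      (contactLocus_segreVeronese_subsingleton hn hd x ha hb hx
        (hL.trans (tangentSpan_one _ x).le)) (hWpos L hLW)
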